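/- Let $\Gamma$ be a countably infinite connected graph with symmetric edge weights $\mu_{x,y}=\mu_{y,x}>0$ for $x\sim y$ (and $\mu_{x,y}=0$ otherwise), and with $\mu(x)=\sum_{y\sim x}\mu_{x,y}<\infty$. Put $P(x,y)=\mu_{x,y}/\mu(x)$, $Pf(x)=\sum_y P(x,y)f(y)$, $\Delta=P-I$, $(f,g)_\mu=\sum_x f(x)g(x)\mu(x)$, let $d$ be the graph distance and $B(x,R)=\{y: d(x,y)<R\}$. For disjoint $A,B\subset\Gamma$ let $$\rho(A,B)=\Bigl(\inf\{(-\Delta f,f)_\mu : f \text{ finitely supported},\ f|_A=1,\ f|_B=0\}\Bigr)^{-1},\qquad \rho(x,r,R)=\rho\bigl(B(x,r),\Gamma\setminus B(x,R)\bigr).$$ Assume - $(p_0)$: there is $p_0>0$ with $\mu_{x,y}/\mu(x)\ge p_0$ for all $x\sim y$; - $(H)$: there is $H>1$ such that for all $x\in\Gamma$, all real $R>0$ and every function $u\ge 0$ defined on $B(x,2R)$ and its neighbours with $Pu=u$ on $B(x,2R)$, one has $\max_{B(x,R)}u\le H\min_{B(x,R)}u$. Then there is a constant $C_2>1$ such that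 for all $x\in\Gamma$ and all real $R>0$ $$\rho(x,R,4R)\le C_2\,\rho(x,2R,4R)\quad\text{and}\quad \rho(x,R,2R)\le (C_2-1)\,\rho(x,2R,4R).$$ If in addition - $(BC)$: there is an integer $K$ such that for all $x\in\Gamma$ and $R>0$ the ball $B(x,2R)$ can be covered by at most $K$ balls of radius $R$, then there is also a constant $C_1>1$ such that for all $x\in\Gamma$ and all real $R>0$ $$\rho(x,R,4R)\le C_1\,\rho(x,R,2R)\quad\text{and}\quad \rho(x,2R,4R)\le (C_1-1)\,\rho(x,R,2R),$$ and hence, with the same $C_2$ as above, $$\frac{1}{C_1-1}\,\rho(x,2R,4R)\le\rho(x,R,2R)\le (C_2-1)\,\rho(x,2R,4R).$$ -/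

import Mathlib

open scoped ENNReal

/-- A weighted graph `(Γ, μ)`: symmetric weights, positive on the edges and zero off the edges,
such that every vertex has finite total weight. -/
structure WeightedGraph (Γ : Type*) where
  graph : SimpleGraph Γ
  weight : Γ → Γ → ℝ
  weight_symm : ∀ x y, weight x y = weight y x
  weight_pos : ∀ x y, graph.Adj x y → 0 < weight x y
  weight_eq_zero : ∀ x y, ¬ graph.Adj x y → weight x y = 0
  weight_summable : ∀ x, Summable (weight x)

namespace WeightedGraph

noncomputable section

variable {Γ : Type*} (G : WeightedGraph Γ)

/-- The vertex weight `μ(x) = ∑_{y ∼ x} μ_{x,y}`. -/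
def vertexWeight (x : Γ) : ℝ := ∑' y, G.weight x y

/-- The transition probability `P(x,y) = μ_{x,y} / μ(x)`. -/
def transition (x y : Γ) : ℝ := G.weight x y / G.vertexWeight x

/-- The Markov operator `Pf(x) = ∑_y P(x,y) f(y)`. -/
def markovOp (f : Γ → ℝ) (x : Γ) : ℝ := ∑' y, G.transition x y * f y

/-- The Laplace operator `Δ = P - I`. -/
def laplacian (f : Γ → ℝ) (x : Γ) : ℝ := G.markovOp f x - f x

/-- The inner product `(f,g)_μ = ∑_x f(x) g(x) μ(x)`; it is only used when `g` has finite
support. -/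
def innerProd (f g : Γ → ℝ) : ℝ := ∑ᶠ x, f x * g x * G.vertexWeight x

/-- The Dirichlet energy `(-Δf, f)_μ`. -/
def energy (f : Γ → ℝ) : ℝ := G.innerProd (fun x => -G.laplacian f x) f

/-- The open ball `B(x,R) = {y : d(x,y) < R}` of the graph distance. -/
def ball (x : Γ) (R : ℝ) : Set Γ := {y | (G.graph.dist x y : ℝ) < R}

/-- The closure of `A`: `A` together with all neighbours of points of `A`. -/
def closure (A : Set Γ) : Set Γ := {y | y ∈ A ∨ ∃ x ∈ A, G.graph.Adj x y}

/-- The resistance between `A` and `B`, the inverse of the infimum of `(-Δf, f)_μ` over the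
finitely supported `f` with `f = 1` on `A` and `f = 0` on `B`. -/
def resistance (A B : Set Γ) : ℝ≥0∞ :=
  (⨅ f ∈ {f : Γ → ℝ | f.support.Finite ∧ (∀ x ∈ A, f x = 1) ∧ (∀ x ∈ B, f x = 0)},
    ENNReal.ofReal (G.energy f))⁻¹

/-- The resistance `ρ(x,r,R)` of the annulus: between `B(x,r)` and `Γ \ B(x,R)`. -/
def annulusResistance (x : Γ) (r R : ℝ) : ℝ≥0∞ :=
  G.resistance (G.ball x r) (G.ball x R)ᶜ

/-- Condition `(p₀)`. -/
def CondP0 : Prop :=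
  ∃ p₀ : ℝ, 0 < p₀ ∧ ∀ x y, G.graph.Adj x y → p₀ ≤ G.weight x y / G.vertexWeight x

/-- The bounded covering condition `(BC)`. -/
def BoundedCovering : Prop :=
  ∃ K : ℕ, ∀ (x : Γ) (R : ℝ), 0 < R →
    ∃ s : Finset Γ, s.card ≤ K ∧ G.ball x (2 * R) ⊆ ⋃ y ∈ s, G.ball y R

/-- `u` is harmonic on `A`. Only the values of `u` on the closure of `A` matter. -/
def HarmonicOn (u : Γ → ℝ) (A : Set Γ) : Prop :=
  ∀ x ∈ A, G.markovOp u x = u x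

/-- The elliptic Harnack inequality `(H)`. -/
def EllipticHarnack : Prop :=
  ∃ H : ℝ, 1 < H ∧ ∀ (x : Γ) (R : ℝ), 0 < R → ∀ u : Γ → ℝ,
    G.HarmonicOn u (G.ball x (2 * R)) →
    (∀ y ∈ G.closure (G.ball x (2 * R)), 0 ≤ u y) →
    ∀ y ∈ G.ball x R, ∀ z ∈ G.ball x R, u y ≤ H * u z

end

end WeightedGraph

namespace WeightedGraph

variable {Γ : Type*} {G : WeightedGraph Γ}

/-! ### Distances in a connected graph -/

/-! Let `g` be the Green function of `B(x,R')` with pole `x`: zero off the ball, unit net flow out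
of `x`, harmonic at the other points of the ball. Then `ρ(x,r,R')` is at least the minimum of `g` on
`B(x,r)` and at most any positive bound for `g` at distance `≥ r - 1` from `x`
(`le_annulusResistance`, `annulusResistance_le`). So everything reduces to comparing values of Green
functions.

By (H), a Green function varies by at most a constant factor on annuli around its pole
(`IsGreen.annulus_harnack`). Since `ρ(x,R,4R)` and `ρ(x,2R,4R)` are read off the same Green
function, this compares them.

For `ρ(x,R,2R)`, let `g`, `g'` be the Green functions of `B(x,4R)`, `B(x,2R)`, and `M = g(y)` the
maximum of `g` on a sphere. In `h = M - g + g'` the poles cancel, so `h ≥ 0` is harmonic on all of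
`B(x,2R)`. Some `z` has `M - g(z) ≥ cM` (`IsGreen.exists_drop`), and Harnack gives `cM ≤ h(z) ≤ H
h(y) = H g'(y)`.

These arguments need `R` large; for bounded `R`, (p₀) alone gives the bounds. The remaining
inequalities follow from monotonicity of the resistance in both radii. -/

theorem exists_dist_eq_between (hc : G.graph.Connected) {x z : Γ} {k : ℕ}
    (hk : k ≤ G.graph.dist x z) :
    ∃ p, G.graph.dist x p = k ∧ G.graph.dist p z = G.graph.dist x z - k := by
  obtain ⟨w, hw⟩ := hc.exists_walk_length_eq_dist x z
  have h1 := SimpleGraph.dist_le (w.take k)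
  have h2 := SimpleGraph.dist_le (w.drop k)
  have h3 := hc.dist_triangle (u := x) (v := w.getVert k) (w := z)
  simp only [SimpleGraph.Walk.take_length, SimpleGraph.Walk.drop_length] at h1 h2
  exact ⟨w.getVert k, by omega, by omega⟩

theorem dist_le_add_one (hc : G.graph.Connected) (x : Γ) {p q : Γ} (h : G.graph.Adj p q) :
    G.graph.dist x q ≤ G.graph.dist x p + 1 := by
  have h1 := hc.dist_triangle (u := x) (v := p) (w := q)
  rw [SimpleGraph.dist_eq_one_iff_adj.2 h] at h1
  exact h1

theorem finite_dist_le (hc : G.graph.Connected) (hfin : ∀ p, (G.graph.neighborSet p).Finite)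
    (x : Γ) (n : ℕ) : {y | G.graph.dist x y ≤ n}.Finite := by
  induction n with
  | zero =>
    refine (Set.finite_singleton x).subset fun y hy => ?_
    have : G.graph.dist x y = 0 := by simpa using hy
    exact ((hc.dist_eq_zero_iff).1 this).symm
  | succ n ih =>
    refine (ih.union (ih.biUnion fun p _ => hfin p)).subset fun y hy => ?_
    have hy : G.graph.dist x y ≤ n + 1 := hy
    by_cases h : G.graph.dist x y ≤ n
    · exact Or.inl h
    · obtain ⟨p, hp, hpy⟩ := exists_dist_eq_between hc (x := x) (z := y) (k := n) (by omega)
      refine Or.inr (Set.mem_biUnion (x := p) (show _ ≤ n by omega) ?_)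
      exact SimpleGraph.dist_eq_one_iff_adj.1 (by omega)

theorem exists_dist_eq [Infinite Γ] (hc : G.graph.Connected)
    (hfin : ∀ p, (G.graph.neighborSet p).Finite) (x : Γ) (n : ℕ) :
    ∃ y, G.graph.dist x y = n := by
  obtain ⟨z, hz⟩ := (finite_dist_le hc hfin x n).exists_notMem
  obtain ⟨p, hp, -⟩ := exists_dist_eq_between hc (x := x) (z := z) (k := n)
    (by have : ¬ G.graph.dist x z ≤ n := hz; omega)
  exact ⟨p, hp⟩

theorem ball_eq (x : Γ) (R : ℝ) : G.ball x R = {y | G.graph.dist x y < ⌈R⌉₊} := by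
  ext y
  simp [ball, Nat.lt_ceil]

theorem finite_ball (hc : G.graph.Connected) (hfin : ∀ p, (G.graph.neighborSet p).Finite)
    (x : Γ) (R : ℝ) : (G.ball x R).Finite := by
  rw [ball_eq]
  exact (finite_dist_le hc hfin x ⌈R⌉₊).subset fun y hy =>
    (show G.graph.dist x y < _ from hy).le

/-! ### Weights and local finiteness -/

theorem weight_nonneg (x y : Γ) : 0 ≤ G.weight x y := by
  by_cases h : G.graph.Adj x y
  · exact (G.weight_pos x y h).le
  · exact (G.weight_eq_zero x y h).ge

theorem weight_le_vertexWeight (x y : Γ) : G.weight x y ≤ G.vertexWeight x :=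
  (G.weight_summable x).le_tsum y fun _ _ => weight_nonneg _ _

/-- Each neighbour takes at least the share `p₀` of the finite total weight. -/
theorem finite_neighborSet {p₀ : ℝ} (hp : 0 < p₀)
    (h : ∀ x y, G.graph.Adj x y → p₀ ≤ G.weight x y / G.vertexWeight x) (x : Γ) :
    (G.graph.neighborSet x).Finite := by
  by_cases hx : 0 < G.vertexWeight x
  · have ht := (G.weight_summable x).tendsto_cofinite_zero
    have hev := ht.eventually_lt_const (show (0 : ℝ) < p₀ * G.vertexWeight x by positivity)
    refine Set.Finite.subset (Filter.eventually_cofinite.1 hev) fun y hy => ?_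
    have := (le_div_iff₀ hx).1 (h x y hy)
    simpa using this
  · refine Set.Finite.subset Set.finite_empty fun y hy => hx ?_
    exact (G.weight_pos x y hy).trans_le (weight_le_vertexWeight x y)

theorem vertexWeight_pos [Infinite Γ] (hc : G.graph.Connected) (x : Γ) :
    0 < G.vertexWeight x := by
  have : Nontrivial Γ := inferInstance
  obtain ⟨y, hy⟩ := hc.preconnected.exists_adj_of_nontrivial x
  exact (G.weight_pos x y hy).trans_le (weight_le_vertexWeight x y)

/-! ### The net flow out of a vertex -/

/-- The net flow `∑_y μ_{p,y} (u(p) - u(y)) = -μ(p) Δu(p)` out of `p`. -/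
noncomputable def flux (G : WeightedGraph Γ) (u : Γ → ℝ) (p : Γ) : ℝ :=
  ∑ᶠ y, G.weight p y * (u p - u y)

theorem flux_eq_sum (u : Γ → ℝ) {p : Γ} {V : Finset Γ} (hV : ∀ y, G.graph.Adj p y → y ∈ V) :
    G.flux u p = ∑ y ∈ V, G.weight p y * (u p - u y) := by
  refine finsum_eq_sum_of_support_subset _ fun y hy => ?_
  by_contra h
  exact hy (by simp [G.weight_eq_zero p y fun h' => h (hV y h')])

section LocallyFinite

variable (hfin : ∀ p, (G.graph.neighborSet p).Finite)
include hfin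

theorem flux_eq_sum_neighbors (u : Γ → ℝ) (p : Γ) :
    G.flux u p = ∑ y ∈ (hfin p).toFinset, G.weight p y * (u p - u y) :=
  flux_eq_sum u fun y hy => by simpa using hy

theorem flux_eq (u : Γ → ℝ) (p : Γ) (hp : 0 < G.vertexWeight p) :
    G.flux u p = G.vertexWeight p * (u p - G.markovOp u p) := by
  have h1 : G.vertexWeight p = ∑ y ∈ (hfin p).toFinset, G.weight p y :=
    tsum_eq_sum fun y hy => G.weight_eq_zero p y (by simpa using hy)
  have h2 : G.markovOp u p = ∑ y ∈ (hfin p).toFinset, G.transition p y * u y :=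
    tsum_eq_sum fun y hy => by
      simp [transition, G.weight_eq_zero p y (by simpa using hy)]
  have h3 : G.vertexWeight p * G.markovOp u p = ∑ y ∈ (hfin p).toFinset, G.weight p y * u y := by
    rw [h2, Finset.mul_sum]
    refine Finset.sum_congr rfl fun y _ => ?_
    simp only [transition]
    field_simp
  rw [flux_eq_sum_neighbors hfin, mul_sub, h3, h1, Finset.sum_mul, ← Finset.sum_sub_distrib]
  exact Finset.sum_congr rfl fun y _ => by ring

theorem flux_combination (a b c : ℝ) (u v : Γ → ℝ) (p : Γ) :
    G.flux (fun q => a + b * u q + c * v q) p = b * G.flux u p + c * G.flux v p := by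
  simp only [flux_eq_sum_neighbors hfin, Finset.mul_sum, ← Finset.sum_add_distrib]
  exact Finset.sum_congr rfl fun y _ => by ring

theorem flux_affine (a b : ℝ) (u : Γ → ℝ) (p : Γ) :
    G.flux (fun q => a + b * u q) p = b * G.flux u p := by
  have := flux_combination hfin a b 0 u u p
  simpa using this

/-- A superharmonic function on a finite set that is nonnegative on the boundary is
nonnegative. -/
theorem minimum_principle [Infinite Γ] (hc : G.graph.Connected) {U : Set Γ} (hU : U.Finite)
    {u : Γ → ℝ} (hsup : ∀ p ∈ U, 0 ≤ G.flux u p)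
    (hbd : ∀ p ∈ U, ∀ y, G.graph.Adj p y → y ∉ U → 0 ≤ u y) : ∀ p ∈ U, 0 ≤ u p := by
  by_contra! hneg
  obtain ⟨p₁, hp₁, hneg⟩ := hneg
  obtain ⟨p₂, hp₂, hmin⟩ := hU.exists_minimalFor u U ⟨p₁, hp₁⟩
  have hmin : ∀ q ∈ U, u p₂ ≤ u q := fun q hq => by
    rcases le_total (u p₂) (u q) with h | h
    · exact h
    · exact hmin hq h
  have hlt : u p₂ < 0 := (hmin p₁ hp₁).trans_lt hneg
  -- At a negative minimum the flux is a nonnegative sum of nonpositive terms, so all neighbours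
  -- share the minimal value and none of them lies on the nonnegative boundary. By connectedness the
  -- minimum spreads to all of `Γ`, forcing `Γ ⊆ U`.
  have hstep : ∀ p, p ∈ U → u p = u p₂ → ∀ y, G.graph.Adj p y → y ∈ U ∧ u y = u p₂ := by
    intro p hp hpe y hy
    have hle : ∀ z, G.graph.Adj p z → u p ≤ u z := fun z hz => by
      by_cases hzU : z ∈ U
      · exact hpe.trans_le (hmin z hzU)
      · exact (hpe.trans_lt hlt).le.trans (hbd p hp z hz hzU)
    have hs := hsup p hp
    rw [flux_eq_sum_neighbors hfin] at hs
    have hterm : ∀ z ∈ (hfin p).toFinset, G.weight p z * (u p - u z) ≤ 0 := fun z hz =>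
      mul_nonpos_of_nonneg_of_nonpos (weight_nonneg p z)
        (sub_nonpos.2 (hle z (by simpa using hz)))
    have h0 := (Finset.sum_eq_zero_iff_of_nonpos hterm).1 (le_antisymm
      (Finset.sum_nonpos hterm) hs) y (by simpa using hy)
    have huy : u y = u p₂ := by
      rcases mul_eq_zero.1 h0 with h | h
      · exact absurd h (G.weight_pos p y hy).ne'
      · linarith
    refine ⟨?_, huy⟩
    by_contra hyU
    linarith [hbd p hp y hy hyU]
  have hall : ∀ y, y ∈ U ∧ u y = u p₂ := fun y => by
    obtain ⟨w⟩ := hc.preconnected p₂ y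
    have : ∀ a b : Γ, G.graph.Walk a b → a ∈ U ∧ u a = u p₂ → b ∈ U ∧ u b = u p₂ := by
      intro a b w
      induction w with
      | nil => exact id
      | cons h _ ih => exact fun ha => ih (hstep _ ha.1 ha.2 _ h)
    exact this _ _ w ⟨hp₂, rfl⟩
  exact Set.infinite_univ (hU.subset fun y _ => (hall y).1)

end LocallyFinite

/-! ### The Dirichlet form -/

/-- The Dirichlet form of the finite network induced on `V`. -/
noncomputable def form (G : WeightedGraph Γ) (V : Finset Γ) (f g : Γ → ℝ) : ℝ :=
  (∑ p ∈ V, ∑ q ∈ V, G.weight p q * (f p - f q) * (g p - g q)) / 2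

theorem form_comm (V : Finset Γ) (f g : Γ → ℝ) : G.form V f g = G.form V g f := by
  unfold form
  congr 1
  exact Finset.sum_congr rfl fun p _ => Finset.sum_congr rfl fun q _ => by ring

theorem form_mono {V : Finset Γ} {f g f' g' : Γ → ℝ}
    (h : ∀ p q, G.graph.Adj p q →
      (f p - f q) * (g p - g q) ≤ (f' p - f' q) * (g' p - g' q)) :
    G.form V f g ≤ G.form V f' g' := by
  unfold form
  refine div_le_div_of_nonneg_right ?_ (by norm_num)
  refine Finset.sum_le_sum fun p _ => Finset.sum_le_sum fun q _ => ?_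
  by_cases hpq : G.graph.Adj p q
  · rw [mul_assoc, mul_assoc]
    exact mul_le_mul_of_nonneg_left (h p q hpq) (weight_nonneg p q)
  · simp [G.weight_eq_zero p q hpq]

theorem form_sub_smul_self (V : Finset Γ) (f g : Γ → ℝ) (t : ℝ) :
    G.form V (fun p => f p - t * g p) (fun p => f p - t * g p) =
      G.form V f f - 2 * t * G.form V f g + t ^ 2 * G.form V g g := by
  have : ∀ p q, G.weight p q * (f p - t * g p - (f q - t * g q)) *
      (f p - t * g p - (f q - t * g q)) = G.weight p q * (f p - f q) * (f p - f q)
        - 2 * t * (G.weight p q * (f p - f q) * (g p - g q))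
        + t ^ 2 * (G.weight p q * (g p - g q) * (g p - g q)) := fun p q => by ring
  simp only [form, this, Finset.sum_add_distrib, Finset.sum_sub_distrib, ← Finset.mul_sum]
  ring

theorem form_self_nonneg (V : Finset Γ) (f : Γ → ℝ) : 0 ≤ G.form V f f := by
  refine div_nonneg (Finset.sum_nonneg fun p _ => Finset.sum_nonneg fun q _ => ?_) (by norm_num)
  rw [mul_assoc]
  exact mul_nonneg (weight_nonneg p q) (mul_self_nonneg _)

/-- Summation by parts. -/
theorem form_eq_sum_flux {V : Finset Γ} {f g : Γ → ℝ}
    (hV : ∀ p, g p ≠ 0 → ∀ q, G.graph.Adj p q → q ∈ V) :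
    G.form V f g = ∑ p ∈ V, g p * G.flux f p := by
  have h1 : ∑ p ∈ V, g p * G.flux f p
      = ∑ p ∈ V, ∑ q ∈ V, G.weight p q * (f p - f q) * g p := by
    refine Finset.sum_congr rfl fun p _ => ?_
    by_cases hp : g p = 0
    · simp [hp]
    · rw [flux_eq_sum f (hV p hp), Finset.mul_sum]
      exact Finset.sum_congr rfl fun q _ => by ring
  have h2 : ∑ p ∈ V, ∑ q ∈ V, G.weight p q * (f p - f q) * g q
      = -∑ p ∈ V, ∑ q ∈ V, G.weight p q * (f p - f q) * g p := by
    rw [Finset.sum_comm, ← Finset.sum_neg_distrib]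
    refine Finset.sum_congr rfl fun p _ => ?_
    rw [← Finset.sum_neg_distrib]
    refine Finset.sum_congr rfl fun q _ => ?_
    rw [G.weight_symm q p]
    ring
  rw [h1]
  simp only [form, mul_sub (G.weight _ _ * _) (g _) (g _), Finset.sum_sub_distrib]
  rw [h2]
  ring

theorem energy_eq_form [Infinite Γ] (hc : G.graph.Connected)
    (hfin : ∀ p, (G.graph.neighborSet p).Finite) {V : Finset Γ} {f : Γ → ℝ}
    (hV₀ : ∀ p, f p ≠ 0 → p ∈ V) (hV : ∀ p, f p ≠ 0 → ∀ q, G.graph.Adj p q → q ∈ V) :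
    G.energy f = G.form V f f := by
  rw [form_eq_sum_flux hV, energy, innerProd, finsum_eq_sum_of_support_subset (s := V)]
  · refine Finset.sum_congr rfl fun p _ => ?_
    rw [flux_eq hfin f p (vertexWeight_pos hc p), laplacian]
    ring
  · intro p hp
    refine hV₀ p fun h => hp (by simp [h])

/-- A finite set containing a finite set and its neighbours. -/
theorem exists_finset_closure (hfin : ∀ p, (G.graph.neighborSet p).Finite) {D : Set Γ}
    (hD : D.Finite) : ∃ V : Finset Γ, (∀ p ∈ D, p ∈ V) ∧
      ∀ p ∈ D, ∀ q, G.graph.Adj p q → q ∈ V := by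
  have h := hD.union (hD.biUnion fun p _ => hfin p)
  refine ⟨h.toFinset, fun p hp => by simp [hp], fun p hp q hq => ?_⟩
  rw [Set.Finite.mem_toFinset]
  exact Or.inr (Set.mem_biUnion hp hq)

/-! ### Green functions of finite sets -/

open scoped Classical in
/-- `g` is the Green function `g_D(x, ·)` of the set `D` with pole `x`. -/
structure IsGreen (G : WeightedGraph Γ) (D : Set Γ) (x : Γ) (g : Γ → ℝ) : Prop where
  eq_zero : ∀ p, p ∉ D → g p = 0
  flux_eq : ∀ p ∈ D, G.flux g p = if p = x then 1 else 0

section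

variable [Infinite Γ] (hc : G.graph.Connected) (hfin : ∀ p, (G.graph.neighborSet p).Finite)
include hc hfin

-- The flux operator with zero boundary values is an endomorphism of the finite-dimensional space of
-- functions on `D`. The minimum principle for `f` and `-f` makes it injective, hence surjective.
open scoped Classical in
theorem exists_isGreen {D : Set Γ} (hD : D.Finite) (x : Γ) : ∃ g, G.IsGreen D x g := by
  have := hD.fintype
  let ext : (D → ℝ) → Γ → ℝ := fun f p => if h : p ∈ D then f ⟨p, h⟩ else 0
  have ext_of_notMem : ∀ f p, p ∉ D → ext f p = 0 := fun f p hp => by simp [ext, hp]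
  have ext_coe : ∀ f (p : D), ext f p = f p := fun f p => by simp [ext]
  let T : (D → ℝ) →ₗ[ℝ] (D → ℝ) :=
    { toFun := fun f p => G.flux (ext f) p
      map_add' := fun f g => by
        funext p
        have : ext (f + g) = fun q => 0 + 1 * ext f q + 1 * ext g q := by
          funext q
          by_cases hq : q ∈ D <;> simp [ext, hq]
        change G.flux (ext (f + g)) p = G.flux (ext f) p + G.flux (ext g) p
        rw [this, flux_combination hfin, one_mul, one_mul]
      map_smul' := fun c f => by
        funext p
        have : ext (c • f) = fun q => 0 + c * ext f q := by
          funext q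
          by_cases hq : q ∈ D <;> simp [ext, hq]
        simp only [this, flux_affine hfin]
        simp }
  have hinj : Function.Injective T := by
    rw [← LinearMap.ker_eq_bot, LinearMap.ker_eq_bot']
    intro f hf
    have hf : ∀ p ∈ D, G.flux (ext f) p = 0 := fun p hp => congrFun hf ⟨p, hp⟩
    have h1 := minimum_principle hfin hc hD (u := ext f) (fun p hp => (hf p hp).ge)
      fun p _ y _ hy => (ext_of_notMem f y hy).ge
    have h2 := minimum_principle hfin hc hD (u := fun p => 0 + (-1) * ext f p)
      (fun p hp => by rw [flux_affine hfin, hf p hp]; simp)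
      fun p _ y _ hy => by simp [ext_of_notMem f y hy]
    funext p
    have h1 := h1 p p.2
    have h2 := h2 p p.2
    rw [ext_coe] at h1 h2
    simp only [Pi.zero_apply]
    linarith
  obtain ⟨f, hf⟩ := LinearMap.injective_iff_surjective.1 hinj
    fun p => if (p : Γ) = x then 1 else 0
  exact ⟨ext f, ext_of_notMem f, fun p hp => congrFun hf ⟨p, hp⟩⟩

namespace IsGreen

variable {D : Set Γ} (hD : D.Finite) {x : Γ} {g : Γ → ℝ} (hg : G.IsGreen D x g)
include hD hg

omit [Infinite Γ] hc hfin hD in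
theorem flux_nonneg {p : Γ} (hp : p ∈ D) : 0 ≤ G.flux g p := by
  rw [hg.flux_eq p hp]
  split_ifs <;> norm_num

omit [Infinite Γ] hc hfin hD in
theorem flux_eq_zero {p : Γ} (hp : p ∈ D) (hpx : p ≠ x) : G.flux g p = 0 := by
  rw [hg.flux_eq p hp, if_neg hpx]

omit [Infinite Γ] hc hfin hD in
theorem flux_self (hx : x ∈ D) : G.flux g x = 1 := by
  rw [hg.flux_eq x hx, if_pos rfl]

theorem nonneg (p : Γ) : 0 ≤ g p := by
  by_cases hp : p ∈ D
  · exact minimum_principle hfin hc hD (fun p hp => hg.flux_nonneg hp)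
      (fun p _ y _ hy => (hg.eq_zero y hy).ge) p hp
  · exact (hg.eq_zero p hp).ge

/-- Off `D` the nonnegative function `g` attains its minimum `0`. Thus `-g` is superharmonic
everywhere but at the pole, even across the boundary of `D`. -/
theorem flux_nonpos {p : Γ} (hpx : p ≠ x) : G.flux g p ≤ 0 := by
  by_cases hp : p ∈ D
  · exact (hg.flux_eq_zero hp hpx).le
  · rw [flux_eq_sum_neighbors hfin, hg.eq_zero p hp]
    refine Finset.sum_nonpos fun y _ => mul_nonpos_of_nonneg_of_nonpos (weight_nonneg p y) ?_
    linarith [hg.nonneg hc hfin hD y]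

/-- The Green function is bounded outside a ball around its pole by its values on a sphere. -/
theorem le_of_sphere {n : ℕ} {M : ℝ} (hM : 0 ≤ M)
    (hs : ∀ p, G.graph.dist x p = n → g p ≤ M) {p : Γ} (hp : n ≤ G.graph.dist x p) :
    g p ≤ M := by
  have key := minimum_principle hfin hc (U := D ∩ {q | n < G.graph.dist x q})
    (u := fun q => M + (-1) * g q) (hD.subset Set.inter_subset_left)
    (fun q hq => by
      have hqx : q ≠ x := by
        rintro rfl
        have : n < G.graph.dist q q := hq.2
        simp at this
      rw [flux_affine hfin, hg.flux_eq_zero hq.1 hqx]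
      simp)
    (fun q hq y hy hyU => by
      by_cases hyD : y ∈ D
      · have h1 : ¬ n < G.graph.dist x y := fun h => hyU ⟨hyD, h⟩
        have h2 : n < G.graph.dist x q := hq.2
        have h3 := dist_le_add_one hc x hy.symm
        linarith [hs y (by omega)]
      · simpa [hg.eq_zero y hyD] using hM)
  by_cases hpD : p ∈ D
  · rcases hp.eq_or_lt with h | h
    · exact hs p h.symm
    · linarith [key p ⟨hpD, h⟩]
  · simpa [hg.eq_zero p hpD] using hM

theorem le_pole (p : Γ) : g p ≤ g x :=
  hg.le_of_sphere hc hfin hD (n := 0) (hg.nonneg hc hfin hD x)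
    (fun q hq => by rw [(hc.dist_eq_zero_iff).1 hq]) (Nat.zero_le _)

omit hD in
/-- The Green function is bounded below on a ball around its pole by its values on a sphere. -/
theorem ge_of_sphere {n : ℕ} {m : ℝ} (hn : ∀ p, G.graph.dist x p ≤ n → p ∈ D)
    (hs : ∀ p, G.graph.dist x p = n → m ≤ g p) {p : Γ} (hp : G.graph.dist x p ≤ n) :
    m ≤ g p := by
  have key := minimum_principle hfin hc (U := {q | G.graph.dist x q < n})
    (u := fun q => -m + 1 * g q)
    ((finite_dist_le hc hfin x n).subset fun q hq => (show G.graph.dist x q < n from hq).le)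
    (fun q hq => by
      rw [flux_affine hfin, one_mul]
      exact hg.flux_nonneg (hn q (show G.graph.dist x q < n from hq).le))
    (fun q hq y hy hyU => by
      have h1 : ¬ G.graph.dist x y < n := hyU
      have h2 : G.graph.dist x q < n := hq
      have h3 := dist_le_add_one hc x hy
      linarith [hs y (by omega)])
  rcases hp.eq_or_lt with h | h
  · exact hs p h
  · linarith [key p h]

omit [Infinite Γ] hc hfin hD in
/-- The reproducing property of the Green function. -/
theorem form_eq {V : Finset Γ} (hV₀ : ∀ p ∈ D, p ∈ V)
    (hV : ∀ p ∈ D, ∀ q, G.graph.Adj p q → q ∈ V) (hx : x ∈ D) {f : Γ → ℝ}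
    (hf : ∀ p, p ∉ D → f p = 0) : G.form V g f = f x := by
  have hmem : ∀ p, f p ≠ 0 → p ∈ D := fun p hp => by
    by_contra h
    exact hp (hf p h)
  rw [form_eq_sum_flux fun p hp => hV p (hmem p hp), Finset.sum_eq_single x]
  · rw [hg.flux_self hx, mul_one]
  · intro p _ hpx
    by_cases hp : p ∈ D
    · rw [hg.flux_eq_zero hp hpx, mul_zero]
    · rw [hf p hp, zero_mul]
  · exact fun h => absurd (hV₀ x hx) h

omit [Infinite Γ] hc in
-- Both values equal the Dirichlet form of `g` and `g'`, by the reproducing property.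
theorem symm {y : Γ} {g' : Γ → ℝ} (hg' : G.IsGreen D y g') (hx : x ∈ D) (hy : y ∈ D) :
    g y = g' x := by
  obtain ⟨V, hV₀, hV⟩ := exists_finset_closure hfin hD
  rw [← hg.form_eq hV₀ hV hx hg'.eq_zero,
    ← hg'.form_eq hV₀ hV hy hg.eq_zero, form_comm]

theorem one_le_vertexWeight_mul_pole (hx : x ∈ D) : 1 ≤ G.vertexWeight x * g x := by
  have h1 : G.vertexWeight x = ∑ y ∈ (hfin x).toFinset, G.weight x y :=
    tsum_eq_sum fun y hy => G.weight_eq_zero x y (by simpa using hy)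
  rw [← hg.flux_self hx, flux_eq_sum_neighbors hfin, h1, Finset.sum_mul]
  refine Finset.sum_le_sum fun y _ => mul_le_mul_of_nonneg_left ?_ (weight_nonneg x y)
  linarith [hg.nonneg hc hfin hD y]

end IsGreen

/-! ### Resistance estimates by Green functions -/

/-- The test function is the truncation `f = min(g,m)/m`. Truncation shrinks differences, so its
energy is at most `(1/m) E(g,f) = f(x)/m = 1/m`. -/
theorem le_annulusResistance {x : Γ} {r R : ℝ} {g : Γ → ℝ} (hr : 0 < r) (hrR : r ≤ R)
    (hg : G.IsGreen (G.ball x R) x g) {m : ℝ} (hm : 0 < m) (hgm : ∀ p ∈ G.ball x r, m ≤ g p) :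
    ENNReal.ofReal m ≤ G.annulusResistance x r R := by
  have hD := finite_ball (G := G) hc hfin x R
  obtain ⟨V, hV₀, hV⟩ := exists_finset_closure hfin hD
  have hxr : x ∈ G.ball x r := by simpa [ball] using hr
  have hx : x ∈ G.ball x R := by simpa [ball] using hr.trans_le hrR
  set f : Γ → ℝ := fun p => min (g p) m / m with hf
  have hf0 : ∀ p, p ∉ G.ball x R → f p = 0 := fun p hp => by
    simp [hf, hg.eq_zero p hp, hm.le]
  have hmem : ∀ p, f p ≠ 0 → p ∈ G.ball x R := fun p hp => by
    by_contra h
    exact hp (hf0 p h)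
  have hf1 : ∀ p ∈ G.ball x r, f p = 1 := fun p hp => by
    simp [hf, min_eq_right (hgm p hp), hm.ne']
  have hE : G.energy f ≤ 1 / m := by
    rw [energy_eq_form hc hfin (fun p hp => hV₀ p (hmem p hp)) fun p hp => hV p (hmem p hp)]
    have h1 : G.form V f f ≤ G.form V (fun p => 1 / m * g p) f := by
      refine form_mono fun p q _ => ?_
      have e1 : f p - f q = 1 / m * (min (g p) m - min (g q) m) := by simp only [hf]; ring
      have e2 : 1 / m * g p - 1 / m * g q = 1 / m * (g p - g q) := by ring
      rw [e1, e2]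
      have h : (min (g p) m - min (g q) m) * (min (g p) m - min (g q) m) ≤
          (g p - g q) * (min (g p) m - min (g q) m) := by
        rcases min_cases (g p) m with ⟨hp, _⟩ | ⟨hp, _⟩ <;>
          rcases min_cases (g q) m with ⟨hq, _⟩ | ⟨hq, _⟩ <;> rw [hp, hq] <;> nlinarith
      have h' := mul_le_mul_of_nonneg_left h (show 0 ≤ 1 / m * (1 / m) by positivity)
      calc _ = _ := by ring
        _ ≤ _ := h'
        _ = _ := by ring
    have h2 : G.form V (fun p => 1 / m * g p) f = 1 / m * G.form V g f := by
      rw [form_eq_sum_flux fun p hp => hV p (hmem p hp),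
        form_eq_sum_flux fun p hp => hV p (hmem p hp), Finset.mul_sum]
      refine Finset.sum_congr rfl fun p _ => ?_
      have := flux_affine hfin 0 (1 / m) g p
      simp only [zero_add] at this
      rw [this]
      ring
    rw [h2, hg.form_eq hV₀ hV hx hf0, hf1 x hxr, mul_one] at h1
    exact h1
  rw [annulusResistance, resistance, ENNReal.le_inv_iff_le_inv]
  refine (iInf₂_le f ⟨hD.subset hmem, hf1, hf0⟩).trans ?_
  rw [← ENNReal.ofReal_inv_of_pos hm, ← one_div]
  exact ENNReal.ofReal_le_ofReal hE

/-- Dual to the previous bound: with `k = min(g,M)`, every admissible `f` satisfies `E(f,k) = E(f,g)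
= f(x) = 1`, while `E(k,k) ≤ M`; Cauchy–Schwarz yields `E(f,f) ≥ 1/M`. The `+ 1` in `hgM` is needed
because an edge on which `f` varies may have one end just inside `B(x,r)`. -/
theorem annulusResistance_le {x : Γ} {r R : ℝ} {g : Γ → ℝ} (hr : 0 < r) (hrR : r ≤ R)
    (hg : G.IsGreen (G.ball x R) x g) {M : ℝ} (hM : 0 < M)
    (hgM : ∀ p, r ≤ G.graph.dist x p + 1 → g p ≤ M) :
    G.annulusResistance x r R ≤ ENNReal.ofReal M := by
  have hD := finite_ball (G := G) hc hfin x R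
  obtain ⟨V, hV₀, hV⟩ := exists_finset_closure hfin hD
  have hxr : x ∈ G.ball x r := by simpa [ball] using hr
  have hx : x ∈ G.ball x R := by simpa [ball] using hr.trans_le hrR
  rw [annulusResistance, resistance, ENNReal.inv_le_iff_inv_le,
    ← ENNReal.ofReal_inv_of_pos hM]
  refine le_iInf₂ fun f hf => ENNReal.ofReal_le_ofReal ?_
  obtain ⟨-, hf1, hf0⟩ := hf
  have hmem : ∀ p, f p ≠ 0 → p ∈ G.ball x R := fun p hp => by
    by_contra h
    exact hp (hf0 p h)
  rw [energy_eq_form hc hfin (fun p hp => hV₀ p (hmem p hp)) fun p hp => hV p (hmem p hp)]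
  set k : Γ → ℝ := fun p => min (g p) M with hk
  have hk0 : ∀ p, p ∉ G.ball x R → k p = 0 := fun p hp => by
    simp [hk, hg.eq_zero p hp, hM.le]
  have h1 : G.form V f k = 1 := by
    rw [← hf1 x hxr, ← hg.form_eq hV₀ hV hx hf0, form_comm]
    have hpq : ∀ p q, G.graph.Adj p q →
        (k p - k q) * (f p - f q) = (g p - g q) * (f p - f q) := by
      intro p q hpq
      by_cases hp : p ∈ G.ball x r
      · by_cases hq : q ∈ G.ball x r
        · simp [hf1 p hp, hf1 q hq]
        · have hq : r ≤ (G.graph.dist x q : ℝ) := by simpa [ball] using hq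
          have h1 : (G.graph.dist x q : ℝ) ≤ G.graph.dist x p + 1 := by
            exact_mod_cast dist_le_add_one hc x hpq
          simp only [hk]
          rw [min_eq_left (hgM p (by linarith)), min_eq_left (hgM q (by linarith))]
      · have hp : r ≤ (G.graph.dist x p : ℝ) := by simpa [ball] using hp
        have h1 : (G.graph.dist x p : ℝ) ≤ G.graph.dist x q + 1 := by
          exact_mod_cast dist_le_add_one hc x hpq.symm
        simp only [hk]
        rw [min_eq_left (hgM p (by linarith)), min_eq_left (hgM q (by linarith))]
    exact le_antisymm (form_mono fun p q h => (hpq p q h).le)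
      (form_mono fun p q h => (hpq p q h).ge)
  have h2 : G.form V k k ≤ M := by
    have : G.form V k k ≤ G.form V g k := by
      refine form_mono fun p q _ => ?_
      simp only [hk]
      rcases min_cases (g p) M with ⟨hp, _⟩ | ⟨hp, _⟩ <;>
        rcases min_cases (g q) M with ⟨hq, _⟩ | ⟨hq, _⟩ <;> rw [hp, hq] <;> nlinarith
    rw [hg.form_eq hV₀ hV hx hk0] at this
    exact this.trans (min_le_right _ _)
  -- Cauchy–Schwarz by expanding a square: `0 ≤ E(f,f) - 2/M + E(k,k)/M²`.
  have h3 := form_self_nonneg (G := G) V fun p => f p - M⁻¹ * k p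
  rw [form_sub_smul_self, h1] at h3
  have h4 : M⁻¹ ^ 2 * G.form V k k ≤ M⁻¹ ^ 2 * M :=
    mul_le_mul_of_nonneg_left h2 (by positivity)
  have h5 : M⁻¹ ^ 2 * M = M⁻¹ := by field_simp
  linarith

end

theorem annulusResistance_mono {x : Γ} {r r' R R' : ℝ} (hr : r ≤ r') (hR : R ≤ R') :
    G.annulusResistance x r' R ≤ G.annulusResistance x r R' := by
  rw [annulusResistance, annulusResistance, resistance, resistance, ENNReal.inv_le_inv]
  refine le_iInf₂ fun f hf => iInf₂_le f ⟨hf.1, fun p hp => hf.2.1 p ?_, fun p hp => hf.2.2 p ?_⟩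
  · exact (show (G.graph.dist x p : ℝ) < r from hp).trans_le hr
  · exact fun h => hp ((show (G.graph.dist x p : ℝ) < R from h).trans_le hR)

/-! ### Consequences of the elliptic Harnack inequality -/

/-- The elliptic Harnack inequality with constant `H`. -/
def HarnackWith (G : WeightedGraph Γ) (H : ℝ) : Prop :=
  ∀ (x : Γ) (R : ℝ), 0 < R → ∀ u : Γ → ℝ,
    G.HarmonicOn u (G.ball x (2 * R)) →
    (∀ y ∈ G.closure (G.ball x (2 * R)), 0 ≤ u y) →
    ∀ y ∈ G.ball x R, ∀ z ∈ G.ball x R, u y ≤ H * u z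

section

variable [Infinite Γ] (hc : G.graph.Connected) (hfin : ∀ p, (G.graph.neighborSet p).Finite)
  {H : ℝ} (hH : G.HarnackWith H)
include hc hfin hH

theorem HarnackWith.of_flux {x : Γ} {R : ℝ} {u : Γ → ℝ} (hR : 0 < R)
    (hu : ∀ q ∈ G.ball x (2 * R), G.flux u q = 0)
    (hpos : ∀ q ∈ G.closure (G.ball x (2 * R)), 0 ≤ u q) {y z : Γ}
    (hy : y ∈ G.ball x R) (hz : z ∈ G.ball x R) : u y ≤ H * u z := by
  refine hH x R hR u (fun q hq => ?_) hpos y hy z hz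
  have h1 := hu q hq
  have h2 := vertexWeight_pos hc q
  rw [flux_eq hfin u q h2] at h1
  rcases mul_eq_zero.1 h1 with h | h
  · exact absurd h h2.ne'
  · linarith

theorem HarnackWith.le_of_dist_le {p : Γ} {s : ℕ} {u : Γ → ℝ}
    (hu : ∀ q, G.graph.dist p q ≤ 2 * s → G.flux u q = 0)
    (hpos : ∀ q, G.graph.dist p q ≤ 2 * s + 1 → 0 ≤ u q) {y z : Γ}
    (hy : G.graph.dist p y ≤ s) (hz : G.graph.dist p z ≤ s) : u y ≤ H * u z := by
  -- With radius `s + 1/2`, the open ball of double radius is exactly `{d ≤ 2s}`.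
  have hmem : ∀ q ∈ G.ball p (2 * ((s : ℝ) + 1 / 2)), G.graph.dist p q ≤ 2 * s := fun q hq => by
    have h : (G.graph.dist p q : ℝ) < 2 * ((s : ℝ) + 1 / 2) := hq
    have : G.graph.dist p q < 2 * s + 1 := by
      have : (G.graph.dist p q : ℝ) < ((2 * s + 1 : ℕ) : ℝ) := by push_cast; linarith
      exact_mod_cast this
    omega
  have hball : ∀ q, G.graph.dist p q ≤ s → q ∈ G.ball p ((s : ℝ) + 1 / 2) := fun q hq => by
    have : (G.graph.dist p q : ℝ) ≤ s := by exact_mod_cast hq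
    change (G.graph.dist p q : ℝ) < s + 1 / 2
    linarith
  refine hH.of_flux hc hfin (x := p) (R := (s : ℝ) + 1 / 2) (by positivity)
    (fun q hq => hu q (hmem q hq)) ?_ (hball y hy) (hball z hz)
  rintro q (hq | ⟨q', hq', hadj⟩)
  · exact hpos q ((hmem q hq).trans (Nat.le_succ _))
  · exact hpos q ((dist_le_add_one hc p hadj).trans (Nat.succ_le_succ (hmem q' hq')))

/-- Iterating the Harnack inequality along a geodesic. -/
theorem HarnackWith.chain (hH1 : 1 ≤ H) {s : ℕ} {u : Γ → ℝ} (N : ℕ) {a b : Γ}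
    (hd : G.graph.dist a b ≤ N * s)
    (hu : ∀ p, G.graph.dist a p + G.graph.dist p b = G.graph.dist a b →
      ∀ q, G.graph.dist p q ≤ 2 * s → G.flux u q = 0)
    (hpos : ∀ p, G.graph.dist a p + G.graph.dist p b = G.graph.dist a b →
      ∀ q, G.graph.dist p q ≤ 2 * s + 1 → 0 ≤ u q) : u a ≤ H ^ N * u b := by
  have t := fun a b c => hc.dist_triangle (u := a) (v := b) (w := c)
  induction N generalizing a with
  | zero =>
    have : a = b := (hc.dist_eq_zero_iff).1 (by omega)
    simp [this]
  | succ N ih =>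
    have haa : G.graph.dist a a = 0 := SimpleGraph.dist_self
    have hub : 0 ≤ u b := hpos b (by simp) b (by simp)
    by_cases h : G.graph.dist a b ≤ s
    · have h1 := hH.le_of_dist_le hc hfin (hu a (by omega)) (hpos a (by omega))
        (haa.trans_le (Nat.zero_le s)) h
      refine h1.trans (mul_le_mul_of_nonneg_right ?_ hub)
      exact le_self_pow₀ hH1 (Nat.succ_ne_zero N)
    · obtain ⟨c, hac, hcb⟩ := exists_dist_eq_between hc (x := a) (z := b) (k := s) (by omega)
      have h1 := hH.le_of_dist_le hc hfin (hu a (by omega)) (hpos a (by omega))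
        (haa.trans_le (Nat.zero_le s)) hac.le
      have hsub : ∀ p, G.graph.dist c p + G.graph.dist p b = G.graph.dist c b →
          G.graph.dist a p + G.graph.dist p b = G.graph.dist a b := fun p hp => by
        have := t a c p
        have := t a p b
        omega
      have h2 := ih (a := c) (by rw [Nat.succ_mul] at hd; omega)
        (fun p hp => hu p (hsub p hp)) fun p hp => hpos p (hsub p hp)
      calc u a ≤ H * u c := h1
        _ ≤ H * (H ^ N * u b) := mul_le_mul_of_nonneg_left h2 (by linarith)
        _ = H ^ (N + 1) * u b := by ring

variable {D : Set Γ} (hD : D.Finite) {x : Γ}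
include hD

/-- If the geodesics from `x` to `z` stay away from `y`, then `g_D(y, z)` and `g_D(y, x)`
are comparable. -/
theorem HarnackWith.chain_to_center (hH1 : 1 ≤ H) {s : ℕ}
    (hDx : ∀ p, G.graph.dist x p ≤ 50 * s → p ∈ D) {y z : Γ} {g' : Γ → ℝ}
    (hg' : G.IsGreen D y g')
    (hz : G.graph.dist x z = 9 * s)
    (haway : ∀ p, G.graph.dist x p + G.graph.dist p z = G.graph.dist x z →
      2 * s < G.graph.dist p y) :
    g' x ≤ H ^ 9 * g' z ∧ g' z ≤ H ^ 9 * g' x := by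
  have t := fun a b c => hc.dist_triangle (u := a) (v := b) (w := c)
  have hflux : ∀ p, G.graph.dist x p + G.graph.dist p z = G.graph.dist x z →
      ∀ q, G.graph.dist p q ≤ 2 * s → G.flux g' q = 0 := by
    intro p hp q hq
    have h3 := t x p q
    refine hg'.flux_eq_zero (hDx q (by omega)) ?_
    rintro rfl
    have := haway p hp
    omega
  have hcomm : G.graph.dist z x = G.graph.dist x z := SimpleGraph.dist_comm
  refine ⟨?_, ?_⟩
  · exact hH.chain hc hfin hH1 (s := s) 9 (by omega) hflux
      fun _ _ q _ => hg'.nonneg hc hfin hD q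
  · refine hH.chain hc hfin hH1 (s := s) 9 (by omega) (fun p hp => hflux p ?_)
      fun _ _ q _ => hg'.nonneg hc hfin hD q
    rw [SimpleGraph.dist_comm (u := x) (v := p), SimpleGraph.dist_comm (u := p) (v := z)]
    omega

variable {g : Γ → ℝ} (hg : G.IsGreen D x g)
include hg

/-- Take `y'` where a geodesic from `x` to `y` crosses the sphere of radius `9s`. The rest of the
geodesic has length at most `36s`, and the `2s`-balls around its points miss the pole and stay in
`D`. -/
theorem IsGreen.radial_harnack (hH1 : 1 ≤ H) {s : ℕ} (hs : 1 ≤ s)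
    (hDx : ∀ p, G.graph.dist x p ≤ 50 * s → p ∈ D) {y : Γ}
    (hy : 9 * s ≤ G.graph.dist x y) (hy' : G.graph.dist x y ≤ 45 * s) :
    ∃ y', G.graph.dist x y' = 9 * s ∧ g y ≤ H ^ 36 * g y' ∧ g y' ≤ H ^ 36 * g y := by
  have t := fun a b c => hc.dist_triangle (u := a) (v := b) (w := c)
  obtain ⟨y', hxy', hy'y⟩ := exists_dist_eq_between hc hy
  have hcomm : G.graph.dist y y' = G.graph.dist y' y := SimpleGraph.dist_comm
  have hflux : ∀ p, G.graph.dist y' p + G.graph.dist p y = G.graph.dist y' y →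
      ∀ q, G.graph.dist p q ≤ 2 * s → G.flux g q = 0 := by
    intro p hp q hq
    have h1 := t x y' p
    have h2 := t x p y
    have h3 := t x p q
    have h4 := t x q p
    rw [SimpleGraph.dist_comm (u := q)] at h4
    refine hg.flux_eq_zero (hDx q (by omega)) ?_
    rintro rfl
    rw [SimpleGraph.dist_self] at h4
    omega
  refine ⟨y', hxy', ?_, ?_⟩
  · refine hH.chain hc hfin hH1 (s := s) 36 (by omega) (fun p hp => hflux p ?_)
      fun _ _ q _ => hg.nonneg hc hfin hD q
    rw [SimpleGraph.dist_comm (u := y') (v := p), SimpleGraph.dist_comm (u := p) (v := y)]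
    omega
  · exact hH.chain hc hfin hH1 (s := s) 36 (by omega) hflux
      fun _ _ q _ => hg.nonneg hc hfin hD q

/-- If `y` and `z` are within `4s`, one Harnack ball around `y` suffices. Otherwise geodesics from
`x` to either point stay more than `2s` from the other, and the poles can be moved by symmetry:
`g(y) = g_y(x) ≤ H⁹ g_y(z) = H⁹ g_z(y) ≤ H¹⁸ g_z(x) = H¹⁸ g(z)`. -/
theorem IsGreen.sphere_harnack (hH1 : 1 ≤ H) {s : ℕ} (hs : 1 ≤ s)
    (hDx : ∀ p, G.graph.dist x p ≤ 50 * s → p ∈ D) {y z : Γ}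
    (hy : G.graph.dist x y = 9 * s) (hz : G.graph.dist x z = 9 * s) :
    g y ≤ H ^ 18 * g z := by
  have t := fun a b c => hc.dist_triangle (u := a) (v := b) (w := c)
  have hclose : G.graph.dist y z ≤ 4 * s → g y ≤ H ^ 18 * g z := by
    intro h
    have h1 : g y ≤ H * g z := by
      -- The doubled ball has radius `8s`, which misses the pole at distance `9s`.
      refine hH.le_of_dist_le hc hfin (p := y) (s := 4 * s) (fun q hq => ?_)
        (fun q _ => hg.nonneg hc hfin hD q) (by simp) h
      have h3 := t x y q
      refine hg.flux_eq_zero (hDx q (by omega)) ?_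
      rintro rfl
      rw [SimpleGraph.dist_comm] at hq
      omega
    exact h1.trans (mul_le_mul_of_nonneg_right (le_self_pow₀ hH1 (by norm_num))
      (hg.nonneg hc hfin hD z))
  have hyD : y ∈ D := hDx y (by omega)
  have hzD : z ∈ D := hDx z (by omega)
  have hxD : x ∈ D := hDx x (by simp)
  by_cases hA : ∀ p, G.graph.dist x p + G.graph.dist p z = G.graph.dist x z →
      2 * s < G.graph.dist p y
  · by_cases hB : ∀ p, G.graph.dist x p + G.graph.dist p y = G.graph.dist x y →
        2 * s < G.graph.dist p z
    · obtain ⟨gy, hgy⟩ := exists_isGreen hc hfin hD y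
      obtain ⟨gz, hgz⟩ := exists_isGreen hc hfin hD z
      have h1 := (hH.chain_to_center hc hfin hD hH1 hDx hgy hz hA).1
      have h2 := (hH.chain_to_center hc hfin hD hH1 hDx hgz hy hB).2
      have hpow : (0 : ℝ) ≤ H ^ 9 := by positivity
      rw [hg.symm hfin hD hgy hxD hyD, hg.symm hfin hD hgz hxD hzD]
      rw [hgy.symm hfin hD hgz hyD hzD] at h1
      calc gy x ≤ H ^ 9 * gz y := h1
        _ ≤ H ^ 9 * (H ^ 9 * gz x) := mul_le_mul_of_nonneg_left h2 hpow
        _ = H ^ 18 * gz x := by ring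
    · push Not at hB
      obtain ⟨p, hp, hpz⟩ := hB
      -- A geodesic point `p` within `2s` of `z` has `d(x,p) ≥ 7s`, hence `d(p,y) ≤ 2s`.
      refine hclose ?_
      have h1 := t x p z
      have h2 := t y p z
      rw [SimpleGraph.dist_comm (u := y) (v := p)] at h2
      omega
  · push Not at hA
    obtain ⟨p, hp, hpy⟩ := hA
    refine hclose ?_
    have h1 := t x p y
    have h2 := t y p z
    rw [SimpleGraph.dist_comm (u := y) (v := p)] at h2
    omega

/-- Green functions are comparable on annuli around their pole. -/
theorem IsGreen.annulus_harnack (hH1 : 1 ≤ H) {s : ℕ} (hs : 1 ≤ s)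
    (hDx : ∀ p, G.graph.dist x p ≤ 50 * s → p ∈ D) {y z : Γ}
    (hy : 9 * s ≤ G.graph.dist x y) (hy' : G.graph.dist x y ≤ 45 * s)
    (hz : 9 * s ≤ G.graph.dist x z) (hz' : G.graph.dist x z ≤ 45 * s) :
    g y ≤ H ^ 90 * g z := by
  obtain ⟨y₁, hy₁, h1, -⟩ := hg.radial_harnack hc hfin hH hD hH1 hs hDx hy hy'
  obtain ⟨z₁, hz₁, -, h3⟩ := hg.radial_harnack hc hfin hH hD hH1 hs hDx hz hz'
  have h2 := hg.sphere_harnack hc hfin hH hD hH1 hs hDx hy₁ hz₁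
  calc g y ≤ H ^ 36 * g y₁ := h1
    _ ≤ H ^ 36 * (H ^ 18 * g z₁) := by gcongr
    _ ≤ H ^ 36 * (H ^ 18 * (H ^ 36 * g z)) := by gcongr
    _ = H ^ 90 * g z := by ring

end

section

variable [Infinite Γ] (hc : G.graph.Connected) (hfin : ∀ p, (G.graph.neighborSet p).Finite)
include hc hfin

/-! ### Local comparison under `(p₀)` -/

/-- Superharmonicity at `a` gives `u(a) ≥ Pu(a) ≥ P(a,c) u(c)`. -/
theorem mul_le_of_adj {p₀ : ℝ} (h0 : ∀ x y, G.graph.Adj x y → p₀ ≤ G.weight x y / G.vertexWeight x)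
    {u : Γ → ℝ} {a c : Γ} (hu : ∀ q, 0 ≤ u q) (ha : 0 ≤ G.flux u a) (hac : G.graph.Adj a c) :
    p₀ * u c ≤ u a := by
  have hpos := vertexWeight_pos hc a
  have h1 : G.vertexWeight a = ∑ y ∈ (hfin a).toFinset, G.weight a y :=
    tsum_eq_sum fun y hy => G.weight_eq_zero a y (by simpa using hy)
  have h2 : G.weight a c * u c ≤ ∑ y ∈ (hfin a).toFinset, G.weight a y * u y :=
    Finset.single_le_sum (f := fun y => G.weight a y * u y)
      (fun y _ => mul_nonneg (weight_nonneg a y) (hu y)) (by simpa using hac)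
  rw [flux_eq_sum_neighbors hfin] at ha
  simp only [mul_sub, Finset.sum_sub_distrib, ← Finset.sum_mul, ← h1] at ha
  have h3 : p₀ * G.vertexWeight a ≤ G.weight a c := (le_div_iff₀ hpos).1 (h0 a c hac)
  have h4 := mul_le_mul_of_nonneg_right h3 (hu c)
  refine le_of_mul_le_mul_left ?_ hpos
  linarith

theorem pow_mul_le_of_superharmonic {p₀ : ℝ} (hp₀ : 0 ≤ p₀)
    (h0 : ∀ x y, G.graph.Adj x y → p₀ ≤ G.weight x y / G.vertexWeight x)
    {u : Γ → ℝ} (hu : ∀ q, 0 ≤ u q) (N : ℕ) {a b : Γ} (hd : G.graph.dist a b = N)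
    (hs : ∀ p, G.graph.dist a p + G.graph.dist p b = G.graph.dist a b → 0 ≤ G.flux u p) :
    p₀ ^ N * u b ≤ u a := by
  have t := fun a b c => hc.dist_triangle (u := a) (v := b) (w := c)
  induction N generalizing a with
  | zero =>
    have : a = b := (hc.dist_eq_zero_iff).1 hd
    simp [this]
  | succ N ih =>
    obtain ⟨c, hac, hcb⟩ := exists_dist_eq_between hc (x := a) (z := b) (k := 1) (by omega)
    have h1 := mul_le_of_adj hc hfin h0 hu (hs a (by simp)) (SimpleGraph.dist_eq_one_iff_adj.1 hac)
    have h2 := ih (a := c) (by omega) fun p hp => hs p (by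
      have := t a c p
      have := t a p b
      omega)
    calc p₀ ^ (N + 1) * u b = p₀ * (p₀ ^ N * u b) := by ring
      _ ≤ p₀ * u c := mul_le_mul_of_nonneg_left h2 hp₀
      _ ≤ u a := h1

theorem IsGreen.pow_mul_pole_le {p₀ : ℝ} (hp₀ : 0 ≤ p₀) (hp₁ : p₀ ≤ 1)
    (h0 : ∀ x y, G.graph.Adj x y → p₀ ≤ G.weight x y / G.vertexWeight x)
    {x : Γ} {R : ℝ} {g : Γ → ℝ} (hg : G.IsGreen (G.ball x R) x g) {N : ℕ} {y : Γ}
    (hy : y ∈ G.ball x R) (hN : G.graph.dist x y ≤ N) : p₀ ^ N * g x ≤ g y := by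
  have hD := finite_ball (G := G) hc hfin x R
  have h1 := pow_mul_le_of_superharmonic hc hfin hp₀ h0 (hg.nonneg hc hfin hD)
    (G.graph.dist x y) (a := y) (b := x) SimpleGraph.dist_comm fun p hp => hg.flux_nonneg (by
      have h : G.graph.dist x p ≤ G.graph.dist x y := by
        rw [SimpleGraph.dist_comm (u := x) (v := p), SimpleGraph.dist_comm (u := x) (v := y)]
        omega
      have h : (G.graph.dist x p : ℝ) ≤ G.graph.dist x y := by exact_mod_cast h
      exact h.trans_lt hy)
  exact (mul_le_mul_of_nonneg_right (pow_le_pow_of_le_one hp₀ hp₁ hN)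
    (hg.nonneg hc hfin hD x)).trans h1

theorem IsGreen.pole_pos {x : Γ} {R : ℝ} (hR : 0 < R) {g : Γ → ℝ}
    (hg : G.IsGreen (G.ball x R) x g) : 0 < g x := by
  have h1 := hg.one_le_vertexWeight_mul_pole hc hfin (finite_ball hc hfin x R) (by simpa [ball] using hR)
  exact pos_of_mul_pos_right (zero_lt_one.trans_le h1) (vertexWeight_pos hc x).le

/-- The function `g(x) - g` is nonnegative, superharmonic away from `x`, and equals `g(x)` at a
point `w` just outside the ball. Following a geodesic back from `w`, it is at least `p₀^(⌈R⌉-1)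
g(x)` at a neighbour `y` of `x`, and the unit flux at `x` bounds the flow along the edge to `y`. -/
theorem IsGreen.pow_mul_pole_le_one {p₀ : ℝ} (hp₀ : 0 < p₀) (hp₁ : p₀ ≤ 1)
    (h0 : ∀ x y, G.graph.Adj x y → p₀ ≤ G.weight x y / G.vertexWeight x)
    {x : Γ} {R : ℝ} (hR : 0 < R) {g : Γ → ℝ} (hg : G.IsGreen (G.ball x R) x g) {N : ℕ}
    (hN : R ≤ N) : p₀ ^ N * (G.vertexWeight x * g x) ≤ 1 := by
  have hD := finite_ball (G := G) hc hfin x R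
  have hx : x ∈ G.ball x R := by simpa [ball] using hR
  have hν : 0 < ⌈R⌉₊ := Nat.ceil_pos.2 hR
  obtain ⟨w, hw⟩ := exists_dist_eq hc hfin x ⌈R⌉₊
  obtain ⟨y, hxy, hyw⟩ := exists_dist_eq_between hc (x := x) (z := w) (k := 1) (by omega)
  have hwD : w ∉ G.ball x R := by
    rw [ball_eq]
    exact fun h => absurd (show G.graph.dist x w < _ from h) (by omega)
  have hadj := SimpleGraph.dist_eq_one_iff_adj.1 hxy
  have hv : ∀ q, 0 ≤ g x + (-1) * g q := fun q => by linarith [hg.le_pole hc hfin hD q]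
  have h1 := pow_mul_le_of_superharmonic hc hfin hp₀.le h0 (u := fun q => g x + (-1) * g q) hv
    (⌈R⌉₊ - 1) (a := y) (b := w) (by omega) fun p hp => by
      rw [flux_affine hfin]
      have hpx : p ≠ x := by
        rintro rfl
        rw [SimpleGraph.dist_comm] at hp
        omega
      linarith [hg.flux_nonpos hc hfin hD hpx]
  simp only [hg.eq_zero w hwD, mul_zero, add_zero] at h1
  have h2 : G.weight x y * (g x - g y) ≤ 1 := by
    rw [← hg.flux_self hx, flux_eq_sum_neighbors hfin]
    exact Finset.single_le_sum (f := fun y => G.weight x y * (g x - g y))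
      (fun z _ => mul_nonneg (weight_nonneg x z) (by linarith [hv z])) (by simpa using hadj)
  have h3 := (le_div_iff₀ (vertexWeight_pos hc x)).1 (h0 x y hadj)
  have hgx := (hg.pole_pos hc hfin hR).le
  have hμ := (vertexWeight_pos hc x).le
  have h4 : p₀ ^ N ≤ p₀ * p₀ ^ (⌈R⌉₊ - 1) := by
    rw [← pow_succ', Nat.sub_add_cancel hν]
    exact pow_le_pow_of_le_one hp₀.le hp₁ (Nat.ceil_le.2 hN)
  calc p₀ ^ N * (G.vertexWeight x * g x)
      ≤ p₀ * p₀ ^ (⌈R⌉₊ - 1) * (G.vertexWeight x * g x) := by gcongr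
    _ = p₀ * G.vertexWeight x * (p₀ ^ (⌈R⌉₊ - 1) * g x) := by ring
    _ ≤ p₀ * G.vertexWeight x * (g x - g y) :=
        mul_le_mul_of_nonneg_left (by linarith) (by positivity)
    _ ≤ G.weight x y * (g x - g y) := mul_le_mul_of_nonneg_right h3 (by linarith [hv y])
    _ ≤ 1 := h2

end

theorem le_ofReal_mul {a b : ℝ≥0∞} {M m C : ℝ} (ha : a ≤ ENNReal.ofReal M)
    (hb : ENNReal.ofReal m ≤ b) (hC : 0 ≤ C) (h : M ≤ C * m) : a ≤ ENNReal.ofReal C * b :=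
  calc a ≤ ENNReal.ofReal (C * m) := ha.trans (ENNReal.ofReal_le_ofReal h)
    _ = ENNReal.ofReal C * ENNReal.ofReal m := ENNReal.ofReal_mul hC
    _ ≤ ENNReal.ofReal C * b := by gcongr

section

variable [Infinite Γ] (hc : G.graph.Connected) (hfin : ∀ p, (G.graph.neighborSet p).Finite)
  {p₀ : ℝ} (hp₀ : 0 < p₀) (hp₁ : p₀ ≤ 1)
  (h0 : ∀ x y, G.graph.Adj x y → p₀ ≤ G.weight x y / G.vertexWeight x)
include hc hfin hp₀ hp₁ h0

/-! ### Comparison of annulus resistances at small scales -/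

theorem annulusResistance_inner_small {x : Γ} {R : ℝ} (hR : 0 < R) {N : ℕ} (hN : 2 * R ≤ N) :
    G.annulusResistance x R (4 * R) ≤
      ENNReal.ofReal (p₀ ^ N)⁻¹ * G.annulusResistance x (2 * R) (4 * R) := by
  have hD := finite_ball (G := G) hc hfin x (4 * R)
  obtain ⟨g, hg⟩ := exists_isGreen hc hfin hD x
  have hgx := hg.pole_pos hc hfin (by positivity)
  have hM := annulusResistance_le hc hfin hR (by linarith) hg hgx
    fun p _ => hg.le_pole hc hfin hD p
  refine le_ofReal_mul hM (le_annulusResistance hc hfin (by linarith) (by linarith) hg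
    (m := p₀ ^ N * g x) (by positivity) fun p hp => ?_) (by positivity) ?_
  · have hp : (G.graph.dist x p : ℝ) < 2 * R := hp
    refine hg.pow_mul_pole_le hc hfin hp₀.le hp₁ h0 (hp.trans (by linarith)) ?_
    exact_mod_cast (hp.trans_le hN).le
  · rw [inv_mul_cancel_left₀ (by positivity)]

/-- The two poles are compared through `1 ≤ μ(x) g'(x)` and `p₀^N μ(x) g(x) ≤ 1`; a second factor
`p₀^N` passes from the pole to the minimum of `g'` on `B(x,R)`. -/
theorem annulusResistance_outer_small {x : Γ} {R : ℝ} (hR : 0 < R) {N : ℕ} (hN : 4 * R ≤ N) :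
    G.annulusResistance x R (4 * R) ≤
      ENNReal.ofReal (p₀ ^ (N + N))⁻¹ * G.annulusResistance x R (2 * R) := by
  have hD := finite_ball (G := G) hc hfin x (4 * R)
  have hD' := finite_ball (G := G) hc hfin x (2 * R)
  obtain ⟨g, hg⟩ := exists_isGreen hc hfin hD x
  obtain ⟨g', hg'⟩ := exists_isGreen hc hfin hD' x
  have hgx := hg.pole_pos hc hfin (by positivity)
  have hgx' := hg'.pole_pos hc hfin (by positivity)
  have hM := annulusResistance_le hc hfin hR (by linarith) hg hgx
    fun p _ => hg.le_pole hc hfin hD p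
  refine le_ofReal_mul hM (le_annulusResistance hc hfin hR (by linarith) hg'
    (m := p₀ ^ N * g' x) (by positivity) fun p hp => ?_) (by positivity) ?_
  · have hp : (G.graph.dist x p : ℝ) < R := hp
    refine hg'.pow_mul_pole_le hc hfin hp₀.le hp₁ h0 (hp.trans (by linarith)) ?_
    have hp : (G.graph.dist x p : ℝ) ≤ N := by linarith
    exact_mod_cast hp
  · have h1 := hg.pow_mul_pole_le_one hc hfin hp₀ hp₁ h0 (by positivity) hN
    have h2 := hg'.one_le_vertexWeight_mul_pole hc hfin hD' (by simpa [ball] using hR)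
    have h3 : p₀ ^ N * g x ≤ g' x := by
      refine le_of_mul_le_mul_left ?_ (vertexWeight_pos hc x)
      linarith
    rw [pow_add, mul_inv, mul_assoc, inv_mul_cancel_left₀ (by positivity)]
    exact (le_inv_mul_iff₀ (by positivity)).2 h3

/-! ### Comparison of annulus resistances at large scales -/

variable {H : ℝ} (hH : G.HarnackWith H) (hH1 : 1 ≤ H)
include hH hH1

theorem annulusResistance_inner_large {x : Γ} {R : ℝ} {s : ℕ} (hs : 1 ≤ s)
    (hR₁ : 9 * s + 1 ≤ R) (hR₂ : 2 * R ≤ 45 * s) (hR₃ : 50 * s < 4 * R) :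
    G.annulusResistance x R (4 * R) ≤
      ENNReal.ofReal (H ^ 180) * G.annulusResistance x (2 * R) (4 * R) := by
  have hs' : (1 : ℝ) ≤ s := by exact_mod_cast hs
  have hR : 0 < R := by linarith
  have hD := finite_ball (G := G) hc hfin x (4 * R)
  obtain ⟨g, hg⟩ := exists_isGreen hc hfin hD x
  have hDx : ∀ p, G.graph.dist x p ≤ 50 * s → p ∈ G.ball x (4 * R) := fun p hp => by
    have : (G.graph.dist x p : ℝ) ≤ 50 * s := by exact_mod_cast hp
    exact this.trans_lt hR₃
  obtain ⟨y, hy⟩ := exists_dist_eq hc hfin x (9 * s)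
  have hgx := hg.pole_pos hc hfin (by positivity)
  have hgy : 0 < g y := lt_of_lt_of_le (by positivity)
    (hg.pow_mul_pole_le hc hfin hp₀.le hp₁ h0 (hDx y (by omega)) le_rfl)
  have hHpos : 0 < H := by linarith
  -- The value at a reference point of the sphere `9s` bounds `g` from above outside that sphere
  -- and, through the sphere `45s`, from below on `B(x,2R)`; each costs `H^90`.
  refine le_ofReal_mul (M := H ^ 90 * g y) (m := (H ^ 90)⁻¹ * g y)
    (annulusResistance_le hc hfin hR (by linarith) hg (by positivity) fun p hp => ?_)
    (le_annulusResistance hc hfin (by linarith) (by linarith) hg (by positivity) fun p hp => ?_)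
    (by positivity) (le_of_eq ?_)
  · refine hg.le_of_sphere hc hfin hD (n := 9 * s) (by positivity) (fun q hq => ?_) ?_
    · exact hg.annulus_harnack hc hfin hH hD hH1 hs hDx (by omega) (by omega) (by omega) (by omega)
    · have : (9 * s : ℝ) ≤ G.graph.dist x p := by linarith
      exact_mod_cast this
  · have hp : (G.graph.dist x p : ℝ) < 2 * R := hp
    have hp : (G.graph.dist x p : ℝ) ≤ 45 * s := by linarith
    refine hg.ge_of_sphere hc hfin (n := 45 * s) (fun q hq => hDx q (by omega))
      (fun q hq => ?_) (by exact_mod_cast hp)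
    refine (inv_mul_le_iff₀ (by positivity)).2 ?_
    exact hg.annulus_harnack hc hfin hH hD hH1 hs hDx (by omega) (by omega) (by omega) (by omega)
  · field_simp

/-- In the direction of a point far outside `D`, the Green function of `D` drops by a definite
proportion. -/
theorem IsGreen.exists_drop {D : Set Γ} (hD : D.Finite) {x : Γ} {g : Γ → ℝ}
    (hg : G.IsGreen D x g) {s ν : ℕ} (hs : 1 ≤ s) (hDν : ∀ p, p ∈ D ↔ G.graph.dist x p < ν)
    (hν₁ : 51 * s ≤ ν) (hν₂ : ν ≤ 180 * s) {M : ℝ} (hM : 0 ≤ M)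
    (hgM : ∀ p, 9 * s ≤ G.graph.dist x p → g p ≤ M) :
    ∃ y, G.graph.dist x y = 12 * s ∧ M ≤ H ^ 222 * (M - g y) := by
  have t := fun a b c => hc.dist_triangle (u := a) (v := b) (w := c)
  have hHpos : 0 < H := by linarith
  -- The points within `9s` of `w` lie outside `D`, while the `50s`-ball around `w` and its
  -- neighbours stay at distance at least `9s` from `x`, where `g ≤ M`. The point `y` is at distance
  -- `45s` from `w`.
  obtain ⟨w, hw⟩ := exists_dist_eq hc hfin x (ν + 9 * s)
  obtain ⟨y, hxy, hyw⟩ := exists_dist_eq_between hc (x := x) (z := w) (k := ν - 36 * s) (by omega)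
  obtain ⟨z, hxz, hzy⟩ := exists_dist_eq_between hc (x := x) (z := y) (k := 12 * s) (by omega)
  have hwy : G.graph.dist w y = 45 * s := by rw [SimpleGraph.dist_comm]; omega
  have hB : ∀ p, p ∈ G.ball w (50 * s + 1) ↔ G.graph.dist w p ≤ 50 * s := fun p => by
    rw [← Nat.lt_add_one_iff, ← Nat.cast_lt (α := ℝ)]
    push_cast
    rfl
  have hBfin := finite_ball (G := G) hc hfin w (50 * s + 1)
  obtain ⟨k, hk⟩ := exists_isGreen hc hfin hBfin w
  have hkw := hk.pole_pos hc hfin (by positivity)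
  have hky : 0 < k y := lt_of_lt_of_le (by positivity)
    (hk.pow_mul_pole_le hc hfin hp₀.le hp₁ h0 ((hB y).2 (by omega)) le_rfl)
  -- Barrier: `H^90 k(y) (M - g) ≥ M k` on the annulus around `w`. On the inner boundary `g = 0` and
  -- `k ≤ H^90 k(y)`; on the outer one `k = 0` and `g ≤ M`. At `y` the factor `k(y)` cancels.
  have hcmp := minimum_principle hfin hc
    (U := {q | 9 * s < G.graph.dist w q ∧ G.graph.dist w q ≤ 50 * s})
    (u := fun q => H ^ 90 * k y * M + (-(H ^ 90 * k y)) * g q + (-M) * k q)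
    ((finite_dist_le hc hfin w (50 * s)).subset fun q hq => hq.2)
    (fun q hq => by
      have hq₁ : 9 * s < G.graph.dist w q := hq.1
      have hq₂ : G.graph.dist w q ≤ 50 * s := hq.2
      have hqx : q ≠ x := by
        rintro rfl
        rw [SimpleGraph.dist_comm] at hq₂
        omega
      have hqw : q ≠ w := by
        rintro rfl
        rw [SimpleGraph.dist_self] at hq₁
        omega
      rw [flux_combination hfin, hk.flux_eq_zero ((hB q).2 hq₂) hqw, mul_zero, add_zero]
      exact mul_nonneg_of_nonpos_of_nonpos (neg_nonpos.2 (by positivity))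
        (hg.flux_nonpos hc hfin hD hqx))
    (fun q hq q' hadj hq' => by
      have hq₁ : 9 * s < G.graph.dist w q := hq.1
      have hq₂ : G.graph.dist w q ≤ 50 * s := hq.2
      have h1 := dist_le_add_one hc w hadj
      have h2 := dist_le_add_one hc w hadj.symm
      have h3 := t x q' w
      rw [SimpleGraph.dist_comm (u := q')] at h3
      by_cases h : G.graph.dist w q' ≤ 50 * s
      · have hq'₁ : ¬ 9 * s < G.graph.dist w q' := fun h' => hq' ⟨h', h⟩
        have hg0 : g q' = 0 := hg.eq_zero q' fun h' => by
          have := (hDν q').1 h'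
          omega
        have hkq : k q' ≤ H ^ 90 * k y :=
          hk.annulus_harnack hc hfin hH hBfin hH1 hs (fun p hp => (hB p).2 hp)
            (by omega) (by omega) (by omega) (by omega)
        have := mul_le_mul_of_nonneg_right hkq hM
        rw [hg0]
        linarith
      · have hk0 : k q' = 0 := hk.eq_zero q' fun h' => h ((hB q').1 h')
        have := mul_le_mul_of_nonneg_left (hgM q' (by omega))
          (show 0 ≤ H ^ 90 * k y by positivity)
        rw [hk0]
        linarith) y ⟨by omega, by omega⟩
  have hdrop : M ≤ H ^ 90 * (M - g y) := by
    refine le_of_mul_le_mul_left ?_ hky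
    linarith
  have hyz : G.graph.dist y z = ν - 48 * s := by rw [SimpleGraph.dist_comm]; omega
  have hfar : ∀ p, G.graph.dist y p + G.graph.dist p z = G.graph.dist y z →
      12 * s ≤ G.graph.dist x p ∧ G.graph.dist x p ≤ ν - 36 * s := fun p hp => by
    have h1 := t x p y
    have h2 := t x z p
    rw [SimpleGraph.dist_comm (u := p) (v := y)] at h1
    rw [SimpleGraph.dist_comm (u := z) (v := p)] at h2
    omega
  -- The drop is carried from `y` in to `z` by Harnack for `M - g`; the length `ν - 48s` is at most
  -- `132s`.
  have hchain := hH.chain hc hfin hH1 (s := s) (u := fun q => M + (-1) * g q) 132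
    (a := y) (b := z) (by omega)
    (fun p hp q hq => by
      have h1 := hfar p hp
      have h2 := t x p q
      have h3 := t x q p
      rw [SimpleGraph.dist_comm (u := q)] at h3
      rw [flux_affine hfin, hg.flux_eq_zero ((hDν q).2 (by omega)), mul_zero]
      rintro rfl
      rw [SimpleGraph.dist_self] at h3
      omega)
    (fun p hp q hq => by
      have h1 := hfar p hp
      have h3 := t x q p
      rw [SimpleGraph.dist_comm (u := q)] at h3
      linarith [hgM q (by omega)])
  refine ⟨z, hxz, hdrop.trans ?_⟩
  have hchain : M - g y ≤ H ^ 132 * (M - g z) := by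
    simpa only [neg_mul, one_mul, ← sub_eq_add_neg] using hchain
  calc H ^ 90 * (M - g y) ≤ H ^ 90 * (H ^ 132 * (M - g z)) := by gcongr
    _ = H ^ 222 * (M - g z) := by ring

theorem annulusResistance_outer_large {x : Γ} {R : ℝ} {s : ℕ} (hs : 5 ≤ s)
    (hR₁ : 36 * s ≤ R) (hR₂ : R < 36 * s + 36) :
    G.annulusResistance x R (4 * R) ≤
      ENNReal.ofReal (H ^ 313) * G.annulusResistance x R (2 * R) := by
  have hs' : (5 : ℝ) ≤ s := by exact_mod_cast hs
  have hR : 0 < R := by linarith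
  have hHpos : 0 < H := by linarith
  have hD := finite_ball (G := G) hc hfin x (4 * R)
  have hD' := finite_ball (G := G) hc hfin x (2 * R)
  obtain ⟨g, hg⟩ := exists_isGreen hc hfin hD x
  obtain ⟨g', hg'⟩ := exists_isGreen hc hfin hD' x
  have hDx : ∀ p, G.graph.dist x p ≤ 50 * s → p ∈ G.ball x (2 * R) := fun p hp => by
    have : (G.graph.dist x p : ℝ) ≤ 50 * s := by exact_mod_cast hp
    exact this.trans_lt (by linarith)
  have hsub : ∀ p, p ∈ G.ball x (2 * R) → p ∈ G.ball x (4 * R) := fun p hp =>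
    (show (G.graph.dist x p : ℝ) < 2 * R from hp).trans (by linarith)
  have hsphere : {p | G.graph.dist x p = 9 * s}.Finite :=
    (finite_dist_le hc hfin x (9 * s)).subset fun p hp =>
      (show G.graph.dist x p = 9 * s from hp).le
  -- Choosing `y` as a maximum point on the sphere makes `M - g + g'` equal to `g'` at `y`.
  obtain ⟨y, hy, hmax⟩ := hsphere.exists_maximalFor g _ (exists_dist_eq hc hfin x (9 * s))
  have hy : G.graph.dist x y = 9 * s := hy
  have hgx := hg.pole_pos hc hfin (by positivity)
  have hgy : 0 < g y := lt_of_lt_of_le (by positivity)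
    (hg.pow_mul_pole_le hc hfin hp₀.le hp₁ h0 (hsub y (hDx y (by omega))) le_rfl)
  have hgM : ∀ p, 9 * s ≤ G.graph.dist x p → g p ≤ g y := fun p hp =>
    hg.le_of_sphere hc hfin hD hgy.le (fun q hq => by
      rcases le_total (g q) (g y) with h | h
      · exact h
      · exact hmax hq h) hp
  have hν₁ : 51 * s ≤ ⌈4 * R⌉₊ := by
    have : ((51 * s : ℕ) : ℝ) ≤ 4 * R := by push_cast; linarith
    exact_mod_cast this.trans (Nat.le_ceil _)
  have hν₂ : ⌈4 * R⌉₊ ≤ 180 * s := Nat.ceil_le.2 (by push_cast; linarith)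
  obtain ⟨z, hz, hzM⟩ := hg.exists_drop hc hfin hp₀ hp₁ h0 hH hH1 hD (by omega)
    (fun p => by rw [ball_eq]; rfl) hν₁ hν₂ hgy.le hgM
  -- The unit fluxes at `x` cancel, so Harnack applies on a ball containing the pole.
  have hfluxh : ∀ q ∈ G.ball x (2 * R), G.flux (fun q => g y + (-1) * g q + 1 * g' q) q = 0 := by
    intro q hq
    rw [flux_combination hfin, hg.flux_eq q (hsub q hq), hg'.flux_eq q hq]
    ring
  have hout : ∀ q, q ∉ G.ball x (2 * R) → 0 ≤ g y + (-1) * g q + 1 * g' q := fun q hq => by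
    have h1 : 50 * s < G.graph.dist x q := by
      by_contra! h
      exact hq (hDx q h)
    linarith [hgM q (by omega), hg'.nonneg hc hfin hD' q]
  have hpos : ∀ q, 0 ≤ g y + (-1) * g q + 1 * g' q := fun q => by
    by_cases hq : q ∈ G.ball x (2 * R)
    · exact minimum_principle hfin hc hD' (u := fun q => g y + (-1) * g q + 1 * g' q)
        (fun q hq => (hfluxh q hq).ge) (fun _ _ p _ hp => hout p hp) q hq
    · exact hout q hq
  have hmem : ∀ p, G.graph.dist x p ≤ 12 * s → p ∈ G.ball x R := fun p hp => by
    have : (G.graph.dist x p : ℝ) ≤ 12 * s := by exact_mod_cast hp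
    exact this.trans_lt (by linarith)
  have hharn := hH.of_flux hc hfin hR hfluxh (fun q _ => hpos q) (hmem z hz.le)
    (hmem y (by omega))
  have hkey : g y ≤ H ^ 223 * g' y := by
    have h1 : g y - g z ≤ H * g' y := by
      have := hg'.nonneg hc hfin hD' z
      simp only [neg_mul, one_mul] at hharn
      rw [add_neg_cancel, zero_add] at hharn
      linarith
    calc g y ≤ H ^ 222 * (g y - g z) := hzM
      _ ≤ H ^ 222 * (H * g' y) := by gcongr
      _ = H ^ 223 * g' y := by ring
  have hgy' : 0 < g' y := pos_of_mul_pos_right (hgy.trans_le hkey) (by positivity)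
  refine le_ofReal_mul (M := g y) (m := (H ^ 90)⁻¹ * g' y)
    (annulusResistance_le hc hfin hR (by linarith) hg hgy fun p hp => hgM p ?_)
    (le_annulusResistance hc hfin hR (by linarith) hg' (by positivity) fun p hp => ?_)
    (by positivity) ?_
  · have : (9 * s : ℝ) ≤ G.graph.dist x p := by linarith
    exact_mod_cast this
  · have hp : (G.graph.dist x p : ℝ) < R := hp
    have hp : (G.graph.dist x p : ℝ) ≤ 45 * s := by linarith
    refine hg'.ge_of_sphere hc hfin (n := 45 * s) (fun q hq => hDx q (by omega))
      (fun q hq => ?_) (by exact_mod_cast hp)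
    refine (inv_mul_le_iff₀ (by positivity)).2 ?_
    exact hg'.annulus_harnack hc hfin hH hD' hH1 (by omega) hDx
      (by omega) (by omega) (by omega) (by omega)
  · calc g y ≤ H ^ 223 * g' y := hkey
      _ = H ^ 313 * ((H ^ 90)⁻¹ * g' y) := by
        rw [show (H : ℝ) ^ 313 = H ^ 223 * H ^ 90 by ring]
        field_simp

end

/-! ### Combining small and large scales -/

section

variable [Infinite Γ] (hc : G.graph.Connected) (hp0 : G.CondP0) (hH : G.EllipticHarnack)
include hc hp0 hH

/-- The resistances of `B(x, 4R) \ B(x, R)` and of its two halves are comparable. -/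
theorem exists_annulusResistance_le :
    ∃ C : ℝ, 1 ≤ C ∧ ∀ (x : Γ) (R : ℝ), 0 < R →
      G.annulusResistance x R (4 * R)
        ≤ ENNReal.ofReal C * G.annulusResistance x (2 * R) (4 * R) ∧
      G.annulusResistance x R (4 * R)
        ≤ ENNReal.ofReal C * G.annulusResistance x R (2 * R) := by
  obtain ⟨p₁, hp₁, h1⟩ := hp0
  obtain ⟨H, hH1, hH⟩ := hH
  replace hH : G.HarnackWith H := hH
  have hfin := finite_neighborSet hp₁ h1
  obtain ⟨p₀, hp₀, hp₀1, h0⟩ : ∃ p₀ : ℝ, 0 < p₀ ∧ p₀ ≤ 1 ∧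
      ∀ x y, G.graph.Adj x y → p₀ ≤ G.weight x y / G.vertexWeight x :=
    ⟨min p₁ 1, by positivity, min_le_right _ _, fun x y h => (min_le_left _ _).trans (h1 x y h)⟩
  set C := max (max (p₀ ^ 400)⁻¹ (p₀ ^ (800 + 800))⁻¹) (max (H ^ 180) (H ^ 313)) with hC
  refine ⟨C, ?_, fun x R hR => ?_⟩
  · exact (one_le_pow₀ hH1.le).trans ((le_max_left (H ^ 180) _).trans (le_max_right _ _))
  have lift : ∀ {a b : ℝ≥0∞} {c : ℝ}, a ≤ ENNReal.ofReal c * b → c ≤ C →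
      a ≤ ENNReal.ofReal C * b := fun h hc => h.trans (by gcongr)
  -- For `R ≥ 200` the floors of `R/18` and `R/36` lose little enough to meet the large-scale
  -- constraints, in particular `2R ≤ 45⌊R/18⌋` and `⌊R/36⌋ ≥ 5`.
  rcases le_total R 200 with hR' | hR'
  · refine ⟨lift (annulusResistance_inner_small hc hfin hp₀ hp₀1 h0 hR (N := 400) ?_) ?_,
      lift (annulusResistance_outer_small hc hfin hp₀ hp₀1 h0 hR (N := 800) ?_) ?_⟩
    · push_cast; linarith
    · exact (le_max_left _ _).trans (le_max_left _ _)
    · push_cast; linarith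
    · exact (le_max_right _ _).trans (le_max_left _ _)
  · have hs₁ := Nat.floor_le (show 0 ≤ R / 18 by positivity)
    have hs₂ := Nat.lt_floor_add_one (R / 18)
    have ht₁ := Nat.floor_le (show 0 ≤ R / 36 by positivity)
    have ht₂ := Nat.lt_floor_add_one (R / 36)
    refine ⟨lift (annulusResistance_inner_large hc hfin hp₀ hp₀1 h0 hH hH1.le
      (s := ⌊R / 18⌋₊) ?_ ?_ ?_ ?_) ?_,
      lift (annulusResistance_outer_large hc hfin hp₀ hp₀1 h0 hH hH1.le
      (s := ⌊R / 36⌋₊) ?_ ?_ ?_) ?_⟩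
    · exact Nat.le_floor (by push_cast; linarith)
    · linarith
    · linarith
    · linarith
    · exact (le_max_left _ _).trans (le_max_right _ _)
    · exact Nat.le_floor (by push_cast; linarith)
    · linarith
    · linarith
    · exact (le_max_right _ _).trans (le_max_right _ _)

end

end WeightedGraph

/-- The argument for the upper bound on `ρ(x, R, 4R)` by `ρ(x, R, 2R)` does not use bounded
covering: it follows from `(p₀)` and `(H)` alone. -/
theorem mainTheorem9 {Γ : Type*} [Countable Γ] [Infinite Γ] (G : WeightedGraph Γ)
    (hconn : G.graph.Connected) (hp0 : G.CondP0) (hH : G.EllipticHarnack) :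
    ∃ C₂ : ℝ, 1 < C₂ ∧
      (∀ (x : Γ) (R : ℝ), 0 < R →
        G.annulusResistance x R (4 * R)
            ≤ ENNReal.ofReal C₂ * G.annulusResistance x (2 * R) (4 * R) ∧
        G.annulusResistance x R (2 * R)
            ≤ ENNReal.ofReal (C₂ - 1) * G.annulusResistance x (2 * R) (4 * R)) ∧
      (G.BoundedCovering →
        ∃ C₁ : ℝ, 1 < C₁ ∧
          ∀ (x : Γ) (R : ℝ), 0 < R →
            G.annulusResistance x R (4 * R)
                ≤ ENNReal.ofReal C₁ * G.annulusResistance x R (2 * R) ∧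
            G.annulusResistance x (2 * R) (4 * R)
                ≤ ENNReal.ofReal (C₁ - 1) * G.annulusResistance x R (2 * R) ∧
            ENNReal.ofReal (1 / (C₁ - 1)) * G.annulusResistance x (2 * R) (4 * R)
                ≤ G.annulusResistance x R (2 * R) ∧
            G.annulusResistance x R (2 * R)
                ≤ ENNReal.ofReal (C₂ - 1) * G.annulusResistance x (2 * R) (4 * R)) := by
  obtain ⟨C, hC, h⟩ := WeightedGraph.exists_annulusResistance_le hconn hp0 hH
  have hC' : ENNReal.ofReal C ≤ ENNReal.ofReal (C + 1) := ENNReal.ofReal_le_ofReal (by linarith)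
  have h12 : ∀ (x : Γ) (R : ℝ), 0 < R → G.annulusResistance x R (2 * R)
      ≤ ENNReal.ofReal (C + 1 - 1) * G.annulusResistance x (2 * R) (4 * R) := fun x R hR => by
    rw [add_sub_cancel_right]
    exact (WeightedGraph.annulusResistance_mono le_rfl (by linarith)).trans (h x R hR).1
  -- By monotonicity `ρ(x,R,2R)` and `ρ(x,2R,4R)` are at most `ρ(x,R,4R)`, so `C` itself serves for
  -- them; `C + 1` makes it the constant minus one.
  refine ⟨C + 1, by linarith, fun x R hR => ⟨(h x R hR).1.trans (by gcongr), h12 x R hR⟩,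
    fun _ => ⟨C + 1, by linarith, fun x R hR => ?_⟩⟩
  have h24 : G.annulusResistance x (2 * R) (4 * R)
      ≤ ENNReal.ofReal C * G.annulusResistance x R (2 * R) :=
    (WeightedGraph.annulusResistance_mono (by linarith) le_rfl).trans (h x R hR).2
  refine ⟨(h x R hR).2.trans (by gcongr), by rwa [add_sub_cancel_right], ?_, h12 x R hR⟩
  rw [add_sub_cancel_right, one_div, ENNReal.ofReal_inv_of_pos (by linarith), mul_comm,
    ← div_eq_mul_inv]
  exact ENNReal.div_le_of_le_mul' h24
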